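/- All graphs are finite, with at most one edge, directed or undirected, between two vertices. A path is a sequence of distinct vertices in which consecutive vertices are adjacent; it is partially directed from its first to its last vertex if it has no edge $v_i\leftarrow v_{i+1}$, directed if all its edges are $v_i\to v_{i+1}$, and chordless if no two nonconsecutive vertices on it are adjacent. Two DAGs on the same vertex set are Markov equivalent if they have the same d-separation relations. A CPDAG $\mathcal{G}^*$ is the partially directed graph that represents the Markov equivalence class $[\mathcal{G}]$ of some DAG $\mathcal{G}$: it has the same adjacencies as $\mathcal{G}$, and a directed edge occurs in $\mathcal{G}^*$ if and only if it appears in every DAG in $[\mathcal{G}]$; all other edges of $\mathcal{G}^*$ are undirected. The chain component of $X$ is its connected component in the undirected subgraph of $\mathcal{G}^*$. $Z$ is an ancestor of $Y$ in $\mathcal{G}^*$ if $Z=Y$ or there is a directed path from $Z$ to $Y$ in $\mathcal{G}^*$. $X$ is an explicit cause of $Y$ if there is a common directed path from $X$ to $Y$ in all DAGs of the Markov equivalence class represented by $\mathcal{G}^*$. The critical set $\mathbf{C}_{UV}$ of $U$ with respect to $V$ consists of all vertices adjacent to $U$ that lie on at least one chordless partially directed path from $U$ to $V$ in $\mathcal{G}^*$.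 Proposition. For any two distinct vertices $X, Y$ in a CPDAG $\mathcal{G}^*$ such that $X$ is not an explicit cause of $Y$, $$\mathbf{C}_{XY}=\bigcup_{Z\in\mathbf{Z}}\mathbf{C}_{XZ},$$ where $\mathbf{Z}$ is the set of ancestors of $Y$ in $\mathcal{G}^*$ which are also in the chain component containing $X$. -/

import Mathlib

/-- A partially directed graph on the vertex set `V`: directed edges `dir a b` (that is, `a → b`) and
undirected edges `und.Adj a b` (that is, `a - b`), with at most one edge between two vertices and
no loops. The undirected subgraph of `G` is `G.und`. -/
structure PDGraph (V : Type*) where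
  dir : V → V → Prop
  und : SimpleGraph V
  dir_asymm : ∀ a b, dir a b → ¬ dir b a
  dir_not_und : ∀ a b, dir a b → ¬ und.Adj a b

namespace PDGraph

variable {V : Type*}

/-- Two vertices are adjacent if there is an edge, of any kind, between them. -/
def Adj (G : PDGraph V) (a b : V) : Prop :=
  G.dir a b ∨ G.dir b a ∨ G.und.Adj a b

/-- `l` is a path of `G` from `x` to `y`: a sequence of distinct vertices, consecutive ones being
adjacent, with first vertex `x` and last vertex `y`. -/
def IsPath (G : PDGraph V) (l : List V) (x y : V) : Prop :=
  l.Nodup ∧ l.IsChain G.Adj ∧ l.head? = some x ∧ l.getLast? = some y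

/-- A partially directed path from `x` to `y`: no edge on it points backwards. -/
def IsPartiallyDirectedPath (G : PDGraph V) (l : List V) (x y : V) : Prop :=
  G.IsPath l x y ∧ l.IsChain (fun a b => ¬ G.dir b a)

/-- A directed (causal) path from `x` to `y`: all edges on it are directed and point forward. -/
def IsDirectedPath (G : PDGraph V) (l : List V) (x y : V) : Prop :=
  G.IsPath l x y ∧ l.IsChain G.dir

/-- A sequence of vertices is chordless if no two nonconsecutive vertices of it are adjacent. -/
def Chordless (G : PDGraph V) (l : List V) : Prop :=
  ∀ (i j : ℕ) (hij : i + 1 < j) (hj : j < l.length), ¬ G.Adj (l[i]'(by omega)) (l[j]'hj)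

/-- The ancestors of `y`: `y` itself and every vertex with a directed path to `y`. -/
def ancestors (G : PDGraph V) (y : V) : Set V :=
  {z | z = y ∨ ∃ l, G.IsDirectedPath l z y}

/-- The descendants of `x`: `x` itself and every vertex to which `x` has a directed path. -/
def descendants (G : PDGraph V) (x : V) : Set V :=
  {z | x ∈ G.ancestors z}

/-- The (vertex set of the) chain component of `x`: its connected component in the undirected
subgraph. -/
def chainComponent (G : PDGraph V) (x : V) : Set V :=
  {z | G.und.Reachable x z}

/-- The critical set of `x` with respect to `y`: the vertices adjacent to `x` that lie on at least
one chordless partially directed path from `x` to `y`. -/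
def criticalSet (G : PDGraph V) (x y : V) : Set V :=
  {c | G.Adj x c ∧ ∃ l, G.IsPartiallyDirectedPath l x y ∧ G.Chordless l ∧ c ∈ l}

/-- A directed acyclic graph: all edges are directed and there is no directed cycle. -/
def IsDAG (G : PDGraph V) : Prop :=
  (∀ a b, ¬ G.und.Adj a b) ∧ ∀ v, ¬ Relation.TransGen G.dir v v

/-- `v` is a collider on `l`: it is an intermediate vertex and both edges of `l` at `v` point
to `v`. -/
def IsColliderOn (G : PDGraph V) (l : List V) (v : V) : Prop :=
  ∃ a b, [a, v, b] <:+: l ∧ G.dir a v ∧ G.dir b v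

/-- The path `l` is active (d-connected) given `S`: no endpoint and no non-collider of it is in `S`
(endpoints are never colliders), and every collider on it has a descendant in `S`. -/
def IsActive (G : PDGraph V) (S : Set V) (l : List V) : Prop :=
  (∀ v ∈ l, ¬ G.IsColliderOn l v → v ∉ S) ∧
    ∀ v ∈ l, G.IsColliderOn l v → ∃ d ∈ S, d ∈ G.descendants v

/-- `A` and `B` are d-separated by `S`: every path between a vertex of `A` and a vertex of `B` is
blocked by `S`. -/
def DSep (G : PDGraph V) (A B S : Set V) : Prop :=
  ∀ a ∈ A, ∀ b ∈ B, ∀ l, G.IsPath l a b → ¬ G.IsActive S l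

/-- Markov equivalence: the same d-separation relations among pairwise disjoint sets. -/
def MarkovEquiv (G H : PDGraph V) : Prop :=
  ∀ A B S : Set V, Disjoint A B → Disjoint A S → Disjoint B S →
    (G.DSep A B S ↔ H.DSep A B S)

/-- `Gs` is the completed partially directed acyclic graph (CPDAG) that represents the Markov
equivalence class of the DAG `G`: it has the adjacencies of `G`, and an edge of it is directed
exactly if this directed edge appears in every DAG that is Markov equivalent to `G`. -/
def Represents (Gs G : PDGraph V) : Prop :=
  (∀ a b, Gs.Adj a b ↔ G.Adj a b) ∧
    ∀ a b, Gs.dir a b ↔ ∀ H : PDGraph V, H.IsDAG → G.MarkovEquiv H → H.dir a b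

/-- The Markov equivalence class of DAGs represented by `Gs`. -/
def markovClass (Gs : PDGraph V) : Set (PDGraph V) :=
  {G | G.IsDAG ∧ Gs.Represents G}

/-- `Gs` is a CPDAG: it represents the Markov equivalence class of some DAG. -/
def IsCPDAG (Gs : PDGraph V) : Prop :=
  ∃ G : PDGraph V, G.IsDAG ∧ Gs.Represents G

/-- `x` is an explicit cause of `y`: one and the same sequence of vertices is a causal path
from `x` to `y` in every DAG of the Markov equivalence class represented by `Gs`. -/
def IsExplicitCause (Gs : PDGraph V) (x y : V) : Prop :=
  ∃ l, ∀ G ∈ Gs.markovClass, G.IsDirectedPath l x y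

end PDGraph

namespace PDGraph

open Relation

variable {V : Type*}

/-! The statement rests on two properties of a CPDAG: its directed edges form no cycle, and `a → b -
c` forces `a → c` (`IsCPDAG.dir_of_dir_of_und`). By the second, a directed edge followed by an
undirected one creates a chord, so a chordless partially directed path from `X` to `Y` is undirected
up to some `Z` and directed after it. This `Z` is an ancestor of `Y` in the chain component, and `Z
≠ X` because `X` is not an explicit cause. The critical vertex is the second vertex of the path,
hence already lies on the part up to `Z`.

Conversely, prolong a chordless path `X, c, …, Z` by a directed path from `Z` to `Y`. No vertex `v`
after `Z` is `X` or adjacent to it: `X → v` would make `X` an explicit cause, and the other cases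
lead from `Z` back to `X` and close a directed cycle through the chain component. So the walk from
`c` to `Y` can be shortened to a chordless path (`IsCPDAG.exists_chordless`) and `X` put in front
again.

Most of the work derives the second property from d-separation. For DAGs, Markov equivalence means
equal skeletons and v-structures (Verma and Pearl): separating sets give one direction, reversals of
covered edges (Chickering) the other. The directed edges are then those given by Meek's rules, and
the property follows by induction on the rules (`Compelled.reversiblePart_right`). -/

/-! ### Directed paths and ancestors. -/

theorem dir_irrefl (G : PDGraph V) (a : V) : ¬ G.dir a a := fun h => G.dir_asymm a a h h

theorem dir.ne {G : PDGraph V} {a b : V} (h : G.dir a b) : a ≠ b := by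
  rintro rfl
  exact G.dir_irrefl a h

theorem Adj.symm {G : PDGraph V} {a b : V} (h : G.Adj a b) : G.Adj b a := by
  rcases h with h | h | h
  exacts [Or.inr (Or.inl h), Or.inl h, Or.inr (Or.inr h.symm)]

theorem adj_irrefl (G : PDGraph V) (a : V) : ¬ G.Adj a a := by
  rintro (h | h | h)
  exacts [G.dir_irrefl a h, G.dir_irrefl a h, G.und.loopless.irrefl a h]

theorem IsDAG.adj_iff {G : PDGraph V} (hG : G.IsDAG) {a b : V} :
    G.Adj a b ↔ G.dir a b ∨ G.dir b a := by
  simp [Adj, hG.1 a b]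

/-- A chain of an acyclic relation has no repetitions. -/
theorem nodup_of_isChain_of_acyclic {r : V → V → Prop} (hr : ∀ v, ¬ TransGen r v v) {l : List V}
    (hl : l.IsChain r) : l.Nodup := by
  have h : l.IsChain (TransGen r) := hl.imp fun _ _ h => TransGen.single h
  have h2 : l.Pairwise (TransGen r) := List.isChain_iff_pairwise.mp h
  refine h2.imp ?_
  rintro a b h rfl
  exact hr _ h

theorem reflTransGen_of_isChain {r : V → V → Prop} {l : List V} {x y : V} (hl : l.IsChain r)
    (hx : l.head? = some x) (hy : l.getLast? = some y) : ReflTransGen r x y := by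
  induction l generalizing x with
  | nil => simp at hx
  | cons a l ih =>
    obtain rfl : a = x := by simpa using hx
    cases l with
    | nil =>
      obtain rfl : a = y := by simpa using hy
      exact .refl
    | cons b l =>
      rw [List.isChain_cons_cons] at hl
      exact .head hl.1 (ih hl.2 rfl (by simpa using hy))

theorem exists_isDirectedPath {G : PDGraph V} (hG : ∀ v, ¬ TransGen G.dir v v) {x y : V}
    (h : ReflTransGen G.dir x y) : ∃ l, G.IsDirectedPath l x y := by
  suffices H : ∃ l : List V, l.IsChain G.dir ∧ l.head? = some x ∧ l.getLast? = some y by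
    obtain ⟨l, hl, hx, hy⟩ := H
    exact ⟨l, ⟨nodup_of_isChain_of_acyclic hG hl, hl.imp fun _ _ h => Or.inl h, hx, hy⟩, hl⟩
  induction h using ReflTransGen.head_induction_on with
  | refl => exact ⟨[y], by simp⟩
  | head hab _ ih =>
    obtain ⟨l, hl, hx, hy⟩ := ih
    rename_i a b _
    refine ⟨a :: l, ?_, rfl, ?_⟩
    · rw [List.isChain_cons]
      refine ⟨?_, hl⟩
      intro c hc
      rw [hx] at hc
      obtain rfl : b = c := by simpa using hc
      exact hab
    · cases l with
      | nil => simp at hx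
      | cons c l => simpa using hy

theorem mem_ancestors_iff {G : PDGraph V} (hG : ∀ v, ¬ TransGen G.dir v v) {x y : V} :
    x ∈ G.ancestors y ↔ ReflTransGen G.dir x y := by
  constructor
  · rintro (rfl | ⟨l, hl⟩)
    · exact .refl
    · exact reflTransGen_of_isChain hl.2 hl.1.2.2.1 hl.1.2.2.2
  · exact fun h => Or.inr (exists_isDirectedPath hG h)

/-! ### Active paths and open walks. -/

/-- `v` has a descendant in `S`. -/
def HasDescendantIn (G : PDGraph V) (S : Set V) (v : V) : Prop :=
  ∃ d ∈ S, ReflTransGen G.dir v d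

theorem exists_mem_descendants_iff {G : PDGraph V} (hG : G.IsDAG) {S : Set V} {v : V} :
    (∃ d ∈ S, d ∈ G.descendants v) ↔ G.HasDescendantIn S v := by
  simp only [descendants, Set.mem_ofPred_eq, mem_ancestors_iff hG.2, HasDescendantIn]

/-- `G.Trail S u v i` means that some walk from `u` to `v` is open given `S`, in the sense that
its colliders are in `S` and its other vertices before `v` are not; `i` tells whether it arrives
at `v` through an arrow pointing to `v`. -/
inductive Trail (G : PDGraph V) (S : Set V) (u : V) : V → Bool → Prop
  | start : u ∉ S → Trail G S u u false
  | forward {v w : V} {i : Bool} : Trail G S u v i → v ∉ S → G.dir v w → Trail G S u w true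
  | backward {v w : V} : Trail G S u v false → v ∉ S → G.dir w v → Trail G S u w false
  | collide {v w : V} : Trail G S u v true → v ∈ S → G.dir w v → Trail G S u w false

/-- Follow a directed path from `v` to its descendant up to the first vertex in `S`, collide there
and return along the same edges. -/
theorem Trail.turn {G : PDGraph V} {S : Set V} {u v : V} (h : G.Trail S u v true)
    (hv : G.HasDescendantIn S v) : v ∈ S ∨ G.Trail S u v false := by
  obtain ⟨d, hd, hvd⟩ := hv
  induction hvd using ReflTransGen.head_induction_on with
  | refl => exact Or.inl hd
  | head hab _ ih =>
    rename_i a b _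
    by_cases ha : a ∈ S
    · exact Or.inl ha
    · right
      have hb := h.forward ha hab
      by_cases hbS : b ∈ S
      · exact hb.collide hbS hab
      · rcases ih hb with h' | h'
        · exact absurd h' hbS
        · exact h'.backward hbS hab

theorem Trail.collide_of_hasDescendantIn {G : PDGraph V} {S : Set V} {u v w : V}
    (h : G.Trail S u v true) (hv : G.HasDescendantIn S v) (hw : G.dir w v) :
    G.Trail S u w false := by
  rcases h.turn hv with h' | h'
  · exact h.collide h' hw
  · by_cases hvS : v ∈ S
    · exact h.collide hvS hw
    · exact h'.backward hvS hw

/-- `G.OpenPath S u v l i` means that the reverse of `v :: l` is a path from `u` to `v` all of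
whose vertices before `v` are open given `S`; `i` tells whether it arrives at `v` through an arrow
pointing to `v`. -/
inductive OpenPath (G : PDGraph V) (S : Set V) (u : V) : V → List V → Bool → Prop
  | start : u ∉ S → OpenPath G S u u [] false
  | forward {v w : V} {l : List V} {i : Bool} : OpenPath G S u v l i → v ∉ S → G.dir v w →
      w ∉ v :: l → OpenPath G S u w (v :: l) true
  | backward {v w : V} {l : List V} : OpenPath G S u v l false → v ∉ S → G.dir w v →
      w ∉ v :: l → OpenPath G S u w (v :: l) false
  | collide {v w : V} {l : List V} : OpenPath G S u v l true → G.HasDescendantIn S v →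
      G.dir w v → w ∉ v :: l → OpenPath G S u w (v :: l) false

/-- Cut the path at `x`. If the path enters `x` by an arrow and `x` is not a collider, it leaves `x`
forward and stays directed until it meets a collider, which has a descendant in `S`, or reaches `w`.
-/
theorem OpenPath.truncate {G : PDGraph V} {S : Set V} {u w : V} {l : List V} {i : Bool}
    (h : G.OpenPath S u w l i) : ∀ x ∈ l, ∃ l' j, G.OpenPath S u x l' j ∧ (j = false → x ∉ S) ∧
      (j = true → G.HasDescendantIn S x ∨ (i = true ∧ TransGen G.dir x w)) := by
  induction h with
  | start _ => simp
  | @forward v w l i h hv hd _ ih =>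
    intro x hx
    rcases List.mem_cons.mp hx with rfl | hx
    · exact ⟨l, i, h, fun _ => hv, fun _ => Or.inr ⟨rfl, .single hd⟩⟩
    · obtain ⟨l', j, h1, h2, h3⟩ := ih x hx
      exact ⟨l', j, h1, h2, fun hj => (h3 hj).imp_right fun h => ⟨rfl, h.2.tail hd⟩⟩
  | @backward v w l h hv hd _ ih =>
    intro x hx
    rcases List.mem_cons.mp hx with rfl | hx
    · exact ⟨l, false, h, fun _ => hv, by simp⟩
    · obtain ⟨l', j, h1, h2, h3⟩ := ih x hx
      exact ⟨l', j, h1, h2, fun hj => (h3 hj).imp_right fun h => by simp at h⟩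
  | @collide v w l h hv hd _ ih =>
    intro x hx
    rcases List.mem_cons.mp hx with rfl | hx
    · exact ⟨l, true, h, by simp, fun _ => Or.inl hv⟩
    · obtain ⟨l', j, h1, h2, h3⟩ := ih x hx
      refine ⟨l', j, h1, h2, fun hj => Or.inl ?_⟩
      rcases h3 hj with h | ⟨_, h⟩
      · exact h
      · obtain ⟨d, hd, hvd⟩ := hv
        exact ⟨d, hd, h.to_reflTransGen.trans hvd⟩

/-- A repeated vertex is removed by truncating the path there. This may change the arrival flag, but
only when the status of `w` relative to `S` still allows every continuation open to the walk. -/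
theorem Trail.exists_openPath {G : PDGraph V} {S : Set V} {u w : V} {i : Bool}
    (h : G.Trail S u w i) : ∃ l j, G.OpenPath S u w l j ∧
      (j = i ∨ (i = true ∧ j = false ∧ w ∉ S) ∨
        (i = false ∧ j = true ∧ G.HasDescendantIn S w)) := by
  have back : ∀ {v w : V} {l : List V} {j : Bool}, G.OpenPath S u v l j → G.dir w v →
      (j = false → v ∉ S) → (j = true → G.HasDescendantIn S v) →
      ∃ l j, G.OpenPath S u w l j ∧
      (j = false ∨ (j = true ∧ G.HasDescendantIn S w)) := by
    intro v w l j h hd h0 h1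
    by_cases hw : w ∈ l
    · obtain ⟨l', j', h1', h2, h3⟩ := h.truncate w hw
      refine ⟨l', j', h1', ?_⟩
      cases j' with
      | false => exact Or.inl rfl
      | true =>
        refine Or.inr ⟨rfl, ?_⟩
        rcases h3 rfl with h | ⟨hj, h⟩
        · exact h
        · obtain ⟨d, hd', hvd⟩ := h1 hj
          exact ⟨d, hd', h.to_reflTransGen.trans hvd⟩
    · have hw' : w ∉ v :: l := by simp [hw, hd.ne]
      cases j with
      | false => exact ⟨_, _, h.backward (h0 rfl) hd hw', Or.inl rfl⟩
      | true => exact ⟨_, _, h.collide (h1 rfl) hd hw', Or.inl rfl⟩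
  induction h with
  | start hu => exact ⟨[], false, .start hu, Or.inl rfl⟩
  | @forward v w i _ hv hd ih =>
    obtain ⟨l, j, h, _⟩ := ih
    by_cases hw : w ∈ l
    · obtain ⟨l', j', h1, h2, h3⟩ := h.truncate w hw
      refine ⟨l', j', h1, ?_⟩
      cases j' with
      | false => exact Or.inr (Or.inl ⟨rfl, rfl, h2 rfl⟩)
      | true => exact Or.inl rfl
    · exact ⟨_, _, h.forward hv hd (by simp [hw, hd.ne.symm]), Or.inl rfl⟩
  | @backward v w _ hv hd ih =>
    obtain ⟨l, j, h, hj⟩ := ih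
    obtain ⟨l', j', h', hj'⟩ := back h hd (fun _ => hv) (by rintro rfl; simpa using hj)
    exact ⟨l', j', h', by simpa using hj'⟩
  | @collide v w _ hv hd ih =>
    obtain ⟨l, j, h, hj⟩ := ih
    obtain ⟨l', j', h', hj'⟩ := back h hd (by rintro rfl; simpa using hj)
      (fun _ => ⟨v, hv, .refl⟩)
    exact ⟨l', j', h', by simpa using hj'⟩

theorem isColliderOn_cons_cons {G : PDGraph V} {w v x : V} {l : List V} :
    G.IsColliderOn (w :: v :: l) x ↔
      (x = v ∧ G.dir w v ∧ ∃ b, l.head? = some b ∧ G.dir b v) ∨ G.IsColliderOn (v :: l) x := by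
  simp only [IsColliderOn, List.infix_cons_iff (l₂ := v :: l), List.cons_prefix_cons]
  constructor
  · rintro ⟨a, b, ⟨rfl, rfl, h⟩ | h, ha, hb⟩
    · cases l with
      | nil => simp at h
      | cons c l =>
        rw [List.cons_prefix_cons] at h
        exact Or.inl ⟨rfl, ha, b, by simp [h.1], hb⟩
    · exact Or.inr ⟨a, b, h, ha, hb⟩
  · rintro (⟨rfl, hw, b, hb, hbx⟩ | ⟨a, b, h, ha, hb⟩)
    · refine ⟨w, b, Or.inl ⟨rfl, rfl, ?_⟩, hw, hbx⟩
      cases l with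
      | nil => simp at hb
      | cons c l =>
        obtain rfl : c = b := by simpa using hb
        simp
    · exact ⟨a, b, Or.inr h, ha, hb⟩

theorem not_isColliderOn_singleton {G : PDGraph V} {w x : V} : ¬ G.IsColliderOn [w] x := by
  rintro ⟨a, b, h, _⟩
  simpa using h.length_le

theorem IsColliderOn.mem_tail {G : PDGraph V} {w x : V} {l : List V}
    (h : G.IsColliderOn (w :: l) x) : x ∈ l := by
  induction l generalizing w with
  | nil => exact absurd h not_isColliderOn_singleton
  | cons v l ih =>
    rw [isColliderOn_cons_cons] at h
    rcases h with ⟨rfl, _⟩ | h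
    · simp
    · exact List.mem_cons_of_mem _ (ih h)

/-- The vertices of the tail of `l` satisfy the conditions for an active path. -/
def IsOpenOn (G : PDGraph V) (S : Set V) (l : List V) : Prop :=
  ∀ x ∈ l.tail, (¬ G.IsColliderOn l x → x ∉ S) ∧ (G.IsColliderOn l x → G.HasDescendantIn S x)

theorem isOpenOn_cons_cons {G : PDGraph V} {S : Set V} {w v : V} {l : List V}
    (hl : (v :: l).Nodup) : G.IsOpenOn S (w :: v :: l) ↔ G.IsOpenOn S (v :: l) ∧
      ((G.dir w v ∧ ∃ b, l.head? = some b ∧ G.dir b v) → G.HasDescendantIn S v) ∧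
      (¬ (G.dir w v ∧ ∃ b, l.head? = some b ∧ G.dir b v) → v ∉ S) := by
  have hv : v ∉ l := (List.nodup_cons.mp hl).1
  have hvc : ¬ G.IsColliderOn (v :: l) v := fun h => hv h.mem_tail
  simp only [IsOpenOn, List.tail_cons, List.forall_mem_cons, isColliderOn_cons_cons (w := w)]
  constructor
  · rintro ⟨⟨h1, h2⟩, h3⟩
    refine ⟨fun x hx => ?_, fun h => h2 (Or.inl ⟨trivial, h⟩), fun h => h1 ?_⟩
    · have hxv : x ≠ v := fun e => hv (e ▸ hx)
      simpa only [hxv, false_and, false_or] using h3 x hx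
    · rintro (⟨_, h'⟩ | h')
      exacts [h h', hvc h']
  · rintro ⟨h1, h2, h3⟩
    refine ⟨⟨fun h => h3 fun h' => h (Or.inl ⟨trivial, h'⟩), ?_⟩, fun x hx => ?_⟩
    · rintro (⟨_, h'⟩ | h')
      exacts [h2 h', absurd h' hvc]
    · have hxv : x ≠ v := fun e => hv (e ▸ hx)
      simpa only [hxv, false_and, false_or] using h1 x hx

theorem OpenPath.isPath {G : PDGraph V} {S : Set V} {u w : V} {l : List V} {i : Bool}
    (h : G.OpenPath S u w l i) : G.IsPath (w :: l) w u ∧ G.IsOpenOn S (w :: l) ∧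
      (i = true ↔ ∃ b, l.head? = some b ∧ G.dir b w) := by
  induction h with
  | start _ => simp [IsPath, IsOpenOn]
  | @forward v w l i h hv hd hw ih =>
    obtain ⟨⟨h1, h2, _, h3⟩, h4, h5⟩ := ih
    refine ⟨⟨List.nodup_cons.mpr ⟨hw, h1⟩, List.isChain_cons_cons.mpr ⟨Or.inr (Or.inl hd), h2⟩,
      rfl, by simpa using h3⟩, (isOpenOn_cons_cons h1).mpr ⟨h4, ?_, fun _ => hv⟩, by simp [hd]⟩
    exact fun h' => absurd hd (G.dir_asymm _ _ h'.1)
  | @backward v w l h hv hd hw ih =>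
    obtain ⟨⟨h1, h2, _, h3⟩, h4, h5⟩ := ih
    refine ⟨⟨List.nodup_cons.mpr ⟨hw, h1⟩, List.isChain_cons_cons.mpr ⟨Or.inl hd, h2⟩,
      rfl, by simpa using h3⟩, (isOpenOn_cons_cons h1).mpr ⟨h4, ?_, fun _ => hv⟩,
      by simp [G.dir_asymm _ _ hd]⟩
    exact fun h' => absurd (h5.mpr h'.2) (by simp)
  | @collide v w l h hv hd hw ih =>
    obtain ⟨⟨h1, h2, _, h3⟩, h4, h5⟩ := ih
    refine ⟨⟨List.nodup_cons.mpr ⟨hw, h1⟩, List.isChain_cons_cons.mpr ⟨Or.inl hd, h2⟩,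
      rfl, by simpa using h3⟩, (isOpenOn_cons_cons h1).mpr ⟨h4, fun _ => hv, ?_⟩,
      by simp [G.dir_asymm _ _ hd]⟩
    exact fun h' => absurd ⟨hd, h5.mp rfl⟩ h'

theorem IsOpenOn.exists_trail {G : PDGraph V} (hG : G.IsDAG) {S : Set V} {l : List V} {a b : V}
    (hl : G.IsPath l a b) (ho : G.IsOpenOn S l) (hb : b ∉ S) :
    ∃ i, G.Trail S b a i ∧ (i = true ↔ ∃ c, l.tail.head? = some c ∧ G.dir c a) := by
  induction l generalizing a with
  | nil => simp [IsPath] at hl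
  | cons w l ih =>
    obtain ⟨h1, h2, h3, h4⟩ := hl
    obtain rfl : w = a := by simpa using h3
    cases l with
    | nil =>
      obtain rfl : w = b := by simpa using h4
      exact ⟨false, .start hb, by simp⟩
    | cons v l =>
      rw [List.isChain_cons_cons] at h2
      have hn := (List.nodup_cons.mp h1).2
      rw [isOpenOn_cons_cons hn] at ho
      obtain ⟨i, ht, hi⟩ := ih ⟨hn, h2.2, rfl, by simpa using h4⟩ ho.1
      rcases hG.adj_iff.mp h2.1 with hd | hd
      · refine ⟨false, ?_, by simp [G.dir_asymm _ _ hd]⟩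
        cases i with
        | true => exact ht.collide_of_hasDescendantIn (ho.2.1 ⟨hd, by simpa using hi⟩) hd
        | false =>
          refine ht.backward (ho.2.2 fun h => ?_) hd
          exact absurd (hi.mpr h.2) (by simp)
      · refine ⟨true, ht.forward (ho.2.2 fun h => G.dir_asymm _ _ hd h.1) hd, by simp [hd]⟩

/-- Walks can be extended edge by edge without checking for repetitions, so later arguments use them
in place of active paths. -/
theorem exists_isActive_iff {G : PDGraph V} (hG : G.IsDAG) {S : Set V} {a b : V} (ha : a ∉ S)
    (hb : b ∉ S) : (∃ l, G.IsPath l a b ∧ G.IsActive S l) ↔ ∃ i, G.Trail S b a i := by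
  constructor
  · rintro ⟨l, hl, h⟩
    obtain ⟨i, hi, _⟩ := IsOpenOn.exists_trail hG (S := S) hl (fun x hx =>
      ⟨h.1 x (List.mem_of_mem_tail hx), fun hc =>
        (exists_mem_descendants_iff hG).mp (h.2 x (List.mem_of_mem_tail hx) hc)⟩) hb
    exact ⟨i, hi⟩
  · rintro ⟨i, hi⟩
    obtain ⟨l, j, h, _⟩ := hi.exists_openPath
    obtain ⟨h1, h2, _⟩ := h.isPath
    refine ⟨a :: l, h1, fun v hv hc => ?_, fun v hv hc => ?_⟩
    · rcases List.mem_cons.mp hv with rfl | hv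
      · exact ha
      · exact (h2 v hv).1 hc
    · exact (exists_mem_descendants_iff hG).mpr ((h2 v hc.mem_tail).2 hc)

theorem dSep_iff {G : PDGraph V} (hG : G.IsDAG) {A B S : Set V} (hA : Disjoint A S)
    (hB : Disjoint B S) : G.DSep A B S ↔ ∀ a ∈ A, ∀ b ∈ B, ∀ i, ¬ G.Trail S b a i := by
  refine forall₂_congr fun a ha => forall₂_congr fun b hb => ?_
  have := not_congr (exists_isActive_iff hG (Set.disjoint_left.mp hA ha)
    (Set.disjoint_left.mp hB hb))
  simpa using this

/-! ### Markov equivalent DAGs have the same pattern. -/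

/-- `a → b ← c` is a v-structure of `G`. -/
def IsVStructure (G : PDGraph V) (a b c : V) : Prop :=
  G.dir a b ∧ G.dir c b ∧ a ≠ c ∧ ¬ G.Adj a c

/-- `G` and `H` have the same skeleton and the same v-structures. -/
structure SamePattern (G H : PDGraph V) : Prop where
  adj : ∀ a b, G.Adj a b ↔ H.Adj a b
  vStructure : ∀ a b c, G.IsVStructure a b c ↔ H.IsVStructure a b c

theorem MarkovEquiv.refl (G : PDGraph V) : G.MarkovEquiv G := fun _ _ _ _ _ _ => Iff.rfl

theorem MarkovEquiv.symm {G H : PDGraph V} (h : G.MarkovEquiv H) : H.MarkovEquiv G :=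
  fun A B S h1 h2 h3 => (h A B S h1 h2 h3).symm

theorem MarkovEquiv.trans {G H K : PDGraph V} (h : G.MarkovEquiv H) (h' : H.MarkovEquiv K) :
    G.MarkovEquiv K :=
  fun A B S h1 h2 h3 => (h A B S h1 h2 h3).trans (h' A B S h1 h2 h3)

theorem MarkovEquiv.dSep_singleton_iff {G H : PDGraph V} (h : G.MarkovEquiv H) {a b : V}
    {S : Set V} (hab : a ≠ b) (ha : a ∉ S) (hb : b ∉ S) :
    G.DSep {a} {b} S ↔ H.DSep {a} {b} S :=
  h _ _ _ (by simpa using hab) (by simpa using ha) (by simpa using hb)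

/-- The ancestors of two vertices, other than the two vertices themselves. -/
def properAncestors (G : PDGraph V) (a b : V) : Set V :=
  {v | v ≠ a ∧ v ≠ b ∧ (ReflTransGen G.dir v a ∨ ReflTransGen G.dir v b)}

theorem dSep_properAncestors {G : PDGraph V} (hG : G.IsDAG) {a b : V} (hab : a ≠ b)
    (h : ¬ G.Adj a b) : G.DSep {a} {b} (G.properAncestors a b) := by
  rw [dSep_iff hG (by simp [properAncestors]) (by simp [properAncestors])]
  rintro _ rfl _ rfl i hi
  rename_i a b
  rw [hG.adj_iff] at h
  push Not at h
  -- An open walk from `b` that steps to a non-ancestor can only go forward among non-ancestors.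
  -- Otherwise it can only pass a collider that is a child of `b` and an ancestor of `a`; acyclicity
  -- keeps the next vertex different from `a`, and unless it is `b` the walk is blocked there.
  have key : ∀ {v i}, G.Trail (G.properAncestors a b) b v i →
      (i = true → (¬ ReflTransGen G.dir v a ∧ ¬ ReflTransGen G.dir v b) ∨
        (v ∈ G.properAncestors a b ∧ G.dir b v)) ∧
      (i = false → v = b ∨ v ∈ G.properAncestors a b) := by
    intro v i hi
    induction hi with
    | start => simp
    | @forward v w i hv hvS hd ih =>
      refine ⟨fun _ => ?_, by simp⟩
      cases i with
      | true =>
        rcases ih.1 rfl with ih | ih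
        · exact Or.inl ⟨fun h => ih.1 (h.head hd), fun h => ih.2 (h.head hd)⟩
        · exact absurd ih.1 hvS
      | false =>
        rcases ih.2 rfl with rfl | ih
        · by_cases hw : ReflTransGen G.dir w a ∨ ReflTransGen G.dir w v
          · refine Or.inr ⟨⟨?_, hd.ne.symm, hw⟩, hd⟩
            rintro rfl
            exact h.2 hd
          · exact Or.inl (not_or.mp hw)
        · exact absurd ih hvS
    | @backward v w hv hvS hd ih =>
      refine ⟨by simp, fun _ => ?_⟩
      rcases ih.2 rfl with rfl | ih
      · refine or_iff_not_imp_left.mpr fun hw => ⟨?_, hw, Or.inr (.single hd)⟩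
        rintro rfl
        exact h.1 hd
      · exact absurd ih hvS
    | @collide v w hv hvS hd ih =>
      refine ⟨by simp, fun _ => ?_⟩
      rcases ih.1 rfl with ih | ⟨_, hbv⟩
      · exact absurd hvS.2.2 (by simp [ih])
      · have hva : ReflTransGen G.dir v a := hvS.2.2.resolve_right fun h =>
          hG.2 b (TransGen.head' hbv h)
        refine or_iff_not_imp_left.mpr fun hw => ⟨?_, hw, Or.inl (hva.head hd)⟩
        rintro rfl
        exact hG.2 w (TransGen.head' hd hva)
  have := key hi
  cases i with
  | true =>
    rcases this.1 rfl with h' | h'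
    · exact h'.1 .refl
    · exact h.2 h'.2
  | false =>
    rcases this.2 rfl with h' | h'
    · exact hab h'
    · exact h'.1 rfl

theorem Adj.not_dSep {G : PDGraph V} (hG : G.IsDAG) {a b : V} {S : Set V} (h : G.Adj a b)
    (ha : a ∉ S) (hb : b ∉ S) : ¬ G.DSep {a} {b} S := by
  rw [dSep_iff hG (by simpa using ha) (by simpa using hb)]
  intro hs
  rcases hG.adj_iff.mp h with h | h
  · exact hs a rfl b rfl _ ((Trail.start hb).backward hb h)
  · exact hs a rfl b rfl _ ((Trail.start hb).forward hb h)

theorem MarkovEquiv.adj {G H : PDGraph V} (hG : G.IsDAG) (hH : H.IsDAG) (h : G.MarkovEquiv H)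
    {a b : V} (hab : G.Adj a b) : H.Adj a b := by
  by_contra hn
  have hne : a ≠ b := by
    rintro rfl
    exact G.adj_irrefl a hab
  have ha : a ∉ H.properAncestors a b := by simp [properAncestors]
  have hb : b ∉ H.properAncestors a b := by simp [properAncestors]
  exact hab.not_dSep hG ha hb
    ((h.dSep_singleton_iff hne ha hb).mpr (dSep_properAncestors hH hne hn))

/-- If `H` lacks the v-structure, `b` is a parent of `a` or `c` in `H`, hence in the separating set
of `H`; but in `G` conditioning on the collider `b` connects `a` and `c`. -/
theorem MarkovEquiv.isVStructure {G H : PDGraph V} (hG : G.IsDAG) (hH : H.IsDAG)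
    (h : G.MarkovEquiv H) {a b c : V} (hv : G.IsVStructure a b c) : H.IsVStructure a b c := by
  obtain ⟨hab, hcb, hac, hn⟩ := hv
  have hn' : ¬ H.Adj a c := fun h' => hn (h.symm.adj hH hG h')
  have hab' := hH.adj_iff.mp (h.adj hG hH (Or.inl hab))
  have hcb' := hH.adj_iff.mp (h.adj hG hH (Or.inl hcb))
  by_contra hv'
  have hb : b ∈ H.properAncestors a c := by
    refine ⟨hab.ne.symm, hcb.ne.symm, ?_⟩
    by_cases h1 : H.dir b a
    · exact Or.inl (.single h1)
    · refine Or.inr (.single (hcb'.resolve_left fun h2 => hv' ⟨?_, h2, hac, hn'⟩))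
      exact hab'.resolve_right h1
  have ha : a ∉ H.properAncestors a c := by simp [properAncestors]
  have hc : c ∉ H.properAncestors a c := by simp [properAncestors]
  have hs := (h.dSep_singleton_iff hac ha hc).mpr (dSep_properAncestors hH hac hn')
  rw [dSep_iff hG (by simpa using ha) (by simpa using hc)] at hs
  exact hs a rfl c rfl _ (((Trail.start hc).forward hc hcb).collide hb hab)

theorem MarkovEquiv.samePattern {G H : PDGraph V} (hG : G.IsDAG) (hH : H.IsDAG)
    (h : G.MarkovEquiv H) : G.SamePattern H :=
  ⟨fun _ _ => ⟨h.adj hG hH, h.symm.adj hH hG⟩,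
    fun _ _ _ => ⟨h.isVStructure hG hH, h.symm.isVStructure hH hG⟩⟩

/-! ### Reversal of covered edges. -/

/-- The graph `G` with its directed edge `a → b` reversed. -/
def reverseEdge (G : PDGraph V) (a b : V) (hab : G.dir a b) : PDGraph V where
  dir x y := (G.dir x y ∧ ¬ (x = a ∧ y = b)) ∨ (x = b ∧ y = a)
  und := G.und
  dir_asymm := by
    rintro x y (⟨h, h'⟩ | ⟨hx, hy⟩) (⟨h2, h2'⟩ | ⟨hy2, hx2⟩)
    · exact G.dir_asymm _ _ h h2
    · exact h' ⟨hx2, hy2⟩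
    · exact h2' ⟨hy, hx⟩
    · exact hab.ne (hy.symm.trans hy2)
  dir_not_und := by
    rintro x y (⟨h, _⟩ | ⟨rfl, rfl⟩) h2
    · exact G.dir_not_und _ _ h h2
    · exact G.dir_not_und _ _ hab h2.symm

/-- The edge `a → b` is covered: the parents of `b` are `a` and the parents of `a`. -/
def IsCovered (G : PDGraph V) (a b : V) : Prop :=
  G.dir a b ∧ ∀ p, G.dir p b ↔ p = a ∨ G.dir p a

theorem transGen_insert {r s : V → V → Prop} {a b x y : V}
    (hs : ∀ x y, s x y → r x y ∨ (x = b ∧ y = a)) (h : TransGen s x y) :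
    TransGen r x y ∨ (ReflTransGen r x b ∧ ReflTransGen r a y) := by
  induction h with
  | single h =>
    rcases hs _ _ h with h | ⟨rfl, rfl⟩
    · exact Or.inl (.single h)
    · exact Or.inr ⟨.refl, .refl⟩
  | tail _ h ih =>
    rcases hs _ _ h with h | ⟨rfl, rfl⟩
    · exact ih.imp (fun h' => h'.tail h) fun h' => ⟨h'.1, h'.2.tail h⟩
    · exact Or.inr ⟨ih.elim (fun h' => h'.to_reflTransGen) fun h' => h'.1, .refl⟩

section Covered

variable {G : PDGraph V} {a b : V}

/-- A new cycle needs a second directed path from `a` to `b`; its last vertex before `b` is a parent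
of `a`, which already closes a cycle in `G`. -/
theorem IsCovered.isDAG_reverseEdge (hG : G.IsDAG) (hc : G.IsCovered a b) :
    (G.reverseEdge a b hc.1).IsDAG := by
  refine ⟨hG.1, fun v hv => ?_⟩
  have hsub : ∀ x y, (G.dir x y ∧ ¬ (x = a ∧ y = b)) → G.dir x y := fun _ _ h => h.1
  rcases transGen_insert (r := fun x y => G.dir x y ∧ ¬ (x = a ∧ y = b)) (a := a) (b := b)
    (fun x y h => h) hv with h | ⟨h1, h2⟩
  · exact hG.2 v (TransGen.mono hsub _ _ h)
  · have h := h2.trans h1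
    rcases ReflTransGen.cases_tail h with h | ⟨p, hap, hp, hpa⟩
    · exact hc.1.ne h.symm
    · rcases (hc.2 p).mp hp with rfl | hp'
      · exact hpa ⟨rfl, rfl⟩
      · exact hG.2 a (TransGen.tail' (ReflTransGen.mono hsub _ _ hap) hp')

theorem reverseEdge_adj (hab : G.dir a b) (x y : V) :
    (G.reverseEdge a b hab).Adj x y ↔ G.Adj x y := by
  by_cases h1 : x = a ∧ y = b
  · obtain ⟨rfl, rfl⟩ := h1
    simp [Adj, reverseEdge, hab]
  · by_cases h2 : x = b ∧ y = a
    · obtain ⟨rfl, rfl⟩ := h2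
      simp [Adj, reverseEdge, hab]
    · have h3 : ¬ (y = b ∧ x = a) := fun h => h1 h.symm
      have h4 : ¬ (y = a ∧ x = b) := fun h => h2 h.symm
      simp only [Adj, reverseEdge, h1, h2, h3, h4, and_true, or_false, not_false_eq_true]

theorem IsCovered.reverseEdge_isVStructure_iff (hG : G.IsDAG) (hc : G.IsCovered a b) (x y z : V) :
    (G.reverseEdge a b hc.1).IsVStructure x y z ↔ G.IsVStructure x y z := by
  have hab := hc.1
  have hcov := hc.2
  simp only [IsVStructure, reverseEdge_adj, hG.adj_iff]
  have hasymm := G.dir_asymm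
  simp only [reverseEdge]
  constructor
  · rintro ⟨h1, h2, h3, h4⟩
    refine ⟨?_, ?_, h3, h4⟩ <;> grind
  · rintro ⟨h1, h2, h3, h4⟩
    refine ⟨?_, ?_, h3, h4⟩ <;> grind

theorem IsCovered.trail_reverseEdge (hc : G.IsCovered a b) {S : Set V} {u v : V} {i : Bool}
    (h : G.Trail S u v i) : ∃ j, (G.reverseEdge a b hc.1).Trail S u v j := by
  set H := G.reverseEdge a b hc.1 with hH
  have hba : H.dir b a := Or.inr ⟨rfl, rfl⟩
  have hdir : ∀ {x y}, G.dir x y → ¬ (x = a ∧ y = b) → H.dir x y := fun h h' => Or.inl ⟨h, h'⟩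
  have hab := hc.1
  have hne := hab.ne
  have hnba : ¬ G.dir b a := G.dir_asymm _ _ hab
  have hpb : ∀ {p}, G.dir p a → H.dir p b := fun {p} hp =>
    hdir ((hc.2 p).mpr (Or.inr hp)) fun h => G.dir_irrefl a (h.1 ▸ hp)
  have hpa : ∀ {p}, G.dir p a → H.dir p a := fun {p} hp => hdir hp fun h => hne h.2
  have hpar : ∀ {p}, G.dir p b → p ≠ a → G.dir p a := fun {p} hp hpa =>
    ((hc.2 p).mp hp).resolve_left hpa
  -- Away from `a` and `b` the flag is preserved. The two have the same other parents, so an arrow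
  -- from such a parent into one can be redirected to the other; an arrival across the reversed edge
  -- may instead be recorded by the state at its other end.
  have key : (v ≠ a → v ≠ b → H.Trail S u v i) ∧
      (v = a → i = true → H.Trail S u a true ∧ H.Trail S u b true) ∧
      (v = b → i = true → (H.Trail S u a true ∧ H.Trail S u b true) ∨
        (a ∉ S ∧ H.Trail S u a false) ∨ (b ∉ S ∧ H.Trail S u b false)) ∧
      (v = a → i = false → H.Trail S u a false ∨
        (H.Trail S u a true ∧ H.Trail S u b true ∧ b ∈ S) ∨ (b ∉ S ∧ H.Trail S u b false)) ∧
      (v = b → i = false → H.Trail S u b false) := by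
    have fw : ∀ {x y i}, H.Trail S u x i → x ∉ S → H.dir x y → H.Trail S u y true :=
      fun h1 h2 h3 => h1.forward h2 h3
    have bw : ∀ {x y}, H.Trail S u x false → x ∉ S → H.dir y x → H.Trail S u y false :=
      fun h1 h2 h3 => h1.backward h2 h3
    have co : ∀ {x y}, H.Trail S u x true → x ∈ S → H.dir y x → H.Trail S u y false :=
      fun h1 h2 h3 => h1.collide h2 h3
    clear_value H
    induction h with
    | start hu =>
      have := Trail.start (G := H) hu
      grind
    | @forward v w i hv hvS hd ih =>
      clear hH hv
      by_cases hva : v = a <;> by_cases hvb : v = b <;> by_cases hwa : w = a <;>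
        by_cases hwb : w = b <;> grind
    | @backward v w hv hvS hd ih =>
      clear hH hv
      by_cases hva : v = a <;> by_cases hvb : v = b <;> by_cases hwa : w = a <;>
        by_cases hwb : w = b <;> grind
    | @collide v w hv hvS hd ih =>
      clear hH hv
      by_cases hva : v = a <;> by_cases hvb : v = b <;> by_cases hwa : w = a <;>
        by_cases hwb : w = b <;> grind
  obtain ⟨k0, k1, k2, k3, k4⟩ := key
  by_cases hva : v = a
  · subst hva
    cases i with
    | true => exact ⟨_, (k1 rfl rfl).1⟩
    | false =>
      rcases k3 rfl rfl with h | h | h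
      exacts [⟨_, h⟩, ⟨_, h.1⟩, ⟨_, h.2.forward h.1 hba⟩]
  · by_cases hvb : v = b
    · subst hvb
      cases i with
      | true =>
        rcases k2 rfl rfl with h | h | h
        exacts [⟨_, h.2⟩, ⟨_, h.2.backward h.1 hba⟩, ⟨_, h.2⟩]
      | false => exact ⟨_, k4 rfl rfl⟩
    · exact ⟨_, k0 hva hvb⟩

end Covered

theorem IsCovered.reverseEdge_isCovered {G : PDGraph V} {a b : V} (hc : G.IsCovered a b) :
    (G.reverseEdge a b hc.1).IsCovered b a := by
  obtain ⟨hab, hcov⟩ := hc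
  have h1 := hab.ne
  have h2 := G.dir_asymm a b hab
  have h3 := G.dir_irrefl
  refine ⟨Or.inr ⟨rfl, rfl⟩, fun p => ?_⟩
  simp only [reverseEdge, hcov]
  grind

theorem reverseEdge_reverseEdge {G : PDGraph V} {a b : V} (h : G.dir a b)
    (h' : (G.reverseEdge a b h).dir b a) : (G.reverseEdge a b h).reverseEdge b a h' = G := by
  have h1 := G.dir_asymm a b h
  have : ((G.reverseEdge a b h).reverseEdge b a h').dir = G.dir := by
    funext x y
    simp only [reverseEdge]
    grind
  obtain ⟨_, _, _, _⟩ := G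
  simp only [reverseEdge] at this ⊢
  simp only [this]

theorem IsCovered.markovEquiv {G : PDGraph V} {a b : V} (hG : G.IsDAG) (hc : G.IsCovered a b) :
    G.MarkovEquiv (G.reverseEdge a b hc.1) := by
  intro A B S _ hA hB
  rw [dSep_iff hG hA hB, dSep_iff (hc.isDAG_reverseEdge hG) hA hB]
  refine forall₂_congr fun x _ => forall₂_congr fun y _ => ?_
  rw [← not_exists, ← not_exists, not_iff_not]
  refine ⟨fun ⟨i, hi⟩ => hc.trail_reverseEdge hi, fun ⟨i, hi⟩ => ?_⟩
  have := hc.reverseEdge_isCovered.trail_reverseEdge hi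
  rwa [reverseEdge_reverseEdge] at this

/-! ### DAGs with the same pattern are Markov equivalent. -/

theorem wellFounded_of_acyclic [Finite V] {r : V → V → Prop} (hr : ∀ v, ¬ TransGen r v v) :
    WellFounded r := by
  have : Std.Irrefl (TransGen r) := ⟨hr⟩
  exact Subrelation.wf (fun h => TransGen.single h)
    (Finite.wellFounded_of_trans_of_irrefl (TransGen r))

theorem acyclic_swap {r : V → V → Prop} (hr : ∀ v, ¬ TransGen r v v) :
    ∀ v, ¬ TransGen (Function.swap r) v v :=
  fun v h => hr v (transGen_swap.mp h)

theorem SamePattern.dir_or_dir {G H : PDGraph V} (hH : H.IsDAG) (h : G.SamePattern H) {x y : V}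
    (hxy : G.dir x y) : H.dir x y ∨ H.dir y x :=
  hH.adj_iff.mp ((h.adj x y).mp (Or.inl hxy))

/-- If two DAGs have the same pattern but differ, then some covered edge of the first one is
oriented differently in the second one. -/
theorem SamePattern.exists_isCovered [Finite V] {G H : PDGraph V} (hG : G.IsDAG) (hH : H.IsDAG)
    (h : G.SamePattern H) {x₀ y₀ : V} (hxy : G.dir x₀ y₀) (hyx : H.dir y₀ x₀) :
    ∃ a b, G.IsCovered a b ∧ H.dir b a := by
  -- Among the edges reversed in `H`, take a minimal head `y`, then a maximal tail `x` for it. The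
  -- edges into parents of `y`, and those into `y` from children of `x`, then agree in both graphs,
  -- so a failure of covering would give a cycle or a v-structure present in only one graph.
  obtain ⟨y, ⟨x₁, hx₁⟩, hy⟩ := (wellFounded_of_acyclic hG.2).has_min
    {y | ∃ x, G.dir x y ∧ H.dir y x} ⟨y₀, x₀, hxy, hyx⟩
  obtain ⟨x, ⟨hx, hx'⟩, hxmax⟩ := (wellFounded_of_acyclic (acyclic_swap hG.2)).has_min
    {x | G.dir x y ∧ H.dir y x} ⟨x₁, hx₁⟩
  have hmin : ∀ {z w}, G.dir z w → G.dir w y → H.dir z w := fun {z w} h1 h2 =>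
    (h.dir_or_dir hH h1).resolve_right fun h3 => hy w ⟨z, h1, h3⟩ h2
  have hmax : ∀ {z}, G.dir z y → G.dir x z → H.dir z y := fun {z} h1 h2 =>
    (h.dir_or_dir hH h1).resolve_right fun h3 => hxmax z ⟨h1, h3⟩ h2
  refine ⟨x, y, ⟨hx, fun p => ⟨fun hp => ?_, ?_⟩⟩, hx'⟩
  · by_contra hn
    obtain ⟨hpx, hnpx⟩ := not_or.mp hn
    by_cases hxp : G.dir x p
    · have h1 := hmax hp hxp
      have h2 := hmin hxp hp
      exact hH.2 x ((TransGen.single h2).tail h1 |>.tail hx')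
    · have : G.IsVStructure p y x := ⟨hp, hx, hpx, by rw [hG.adj_iff]; tauto⟩
      exact H.dir_asymm _ _ hx' ((h.vStructure _ _ _).mp this).2.1
  · rintro (rfl | hp)
    · exact hx
    · have h1 := hmin hp hx
      have hpy : p ≠ y := by
        rintro rfl
        exact G.dir_asymm _ _ hx hp
      by_cases ha : H.Adj p y
      · refine (hG.adj_iff.mp ((h.adj p y).mpr ha)).resolve_right fun h2 => ?_
        exact hG.2 p ((TransGen.single hp).tail hx |>.tail h2)
      · have : H.IsVStructure p x y := ⟨h1, hx', hpy, ha⟩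
        exact absurd ((h.vStructure _ _ _).mpr this).2.1 (G.dir_asymm _ _ hx)

/-- Induction on the number of edges on which the graphs differ: reversing a covered edge of
disagreement lowers it and preserves the pattern. -/
theorem SamePattern.markovEquiv [Finite V] {G H : PDGraph V} (hG : G.IsDAG) (hH : H.IsDAG)
    (h : G.SamePattern H) : G.MarkovEquiv H := by
  induction hn : {p : V × V | G.dir p.1 p.2 ∧ H.dir p.2 p.1}.ncard using Nat.strong_induction_on
    generalizing G with
  | _ n ih =>
    by_cases hd : ∃ x y, G.dir x y ∧ H.dir y x
    · obtain ⟨x, y, hxy, hyx⟩ := hd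
      obtain ⟨a, b, hc, hba⟩ := h.exists_isCovered hG hH hxy hyx
      refine (hc.markovEquiv hG).trans (ih _ ?_ (hc.isDAG_reverseEdge hG)
        ⟨fun x y => by rw [reverseEdge_adj, h.adj], fun x y z => by
          rw [hc.reverseEdge_isVStructure_iff hG, h.vStructure]⟩ rfl)
      rw [← hn]
      refine Set.ncard_lt_ncard ⟨?_, fun hsub => ?_⟩ (Set.toFinite _)
      · rintro ⟨u, v⟩ ⟨⟨h1, _⟩ | ⟨h1, h2⟩, h3⟩
        · exact ⟨h1, h3⟩
        · dsimp only at h1 h2 h3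
          subst h1 h2
          exact absurd h3 (H.dir_asymm _ _ hba)
      · rcases (@hsub (a, b) ⟨hc.1, hba⟩).1 with ⟨_, h1⟩ | ⟨h1, _⟩
        · exact h1 ⟨rfl, rfl⟩
        · exact hc.1.ne h1
    · push Not at hd
      have h1 : ∀ x y, G.dir x y ↔ H.dir x y := fun x y =>
        ⟨fun hxy => (h.dir_or_dir hH hxy).resolve_right (hd x y hxy), fun hxy =>
          (hG.adj_iff.mp ((h.adj x y).mpr (Or.inl hxy))).resolve_right fun hyx =>
            H.dir_asymm _ _ hxy ((h.dir_or_dir hH hyx).resolve_right (hd y x hyx))⟩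
      have : G = H := by
        have h2 : G.dir = H.dir := by
          funext x y
          exact propext (h1 x y)
        have h3 : G.und = H.und := by
          ext x y
          simp [hG.1, hH.1]
        obtain ⟨_, _, _, _⟩ := G
        obtain ⟨_, _, _, _⟩ := H
        simp only at h2 h3
        simp only [h2, h3]
      rw [this]
      exact .refl H

/-! ### Meek's rules and the reversible edges. -/

/-- The edges of `G` that are oriented by its v-structures and Meek's orientation rules. -/
inductive Compelled (G : PDGraph V) : V → V → Prop
  | vStructure {a b c : V} : G.IsVStructure a b c → Compelled G a b
  | flow {d a b : V} : Compelled G d a → G.Adj a b → d ≠ b → ¬ G.Adj d b →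
      ¬ G.IsVStructure d a b → Compelled G a b
  | trans {a d b : V} : Compelled G a d → Compelled G d b → G.Adj a b → Compelled G a b
  | diamond {a b c d : V} : G.Adj a c → G.Adj a d → G.Adj a b → c ≠ d → ¬ G.Adj c d →
      ¬ G.IsVStructure c a d → Compelled G c b → Compelled G d b → Compelled G a b

theorem IsVStructure.symm {G : PDGraph V} {a b c : V} (h : G.IsVStructure a b c) :
    G.IsVStructure c b a :=
  ⟨h.2.1, h.1, h.2.2.1.symm, fun h' => h.2.2.2 h'.symm⟩

/-- Against each rule, the opposite orientation would create a directed cycle or a forbidden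
v-structure. -/
theorem Compelled.dir {G : PDGraph V} (hG : G.IsDAG) {a b : V} (h : G.Compelled a b) :
    G.dir a b := by
  induction h with
  | vStructure h => exact h.1
  | flow _ h1 h2 h3 h4 ih =>
    exact (hG.adj_iff.mp h1).resolve_right fun h => h4 ⟨ih, h, h2, h3⟩
  | trans _ _ h ih1 ih2 =>
    exact (hG.adj_iff.mp h).resolve_right fun h' =>
      hG.2 _ (((TransGen.single ih1).tail ih2).tail h')
  | diamond h1 h2 h h3 h4 h5 _ _ ih1 ih2 =>
    refine (hG.adj_iff.mp h).resolve_right fun h' => h5 ⟨?_, ?_, h3, h4⟩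
    · exact (hG.adj_iff.mp h1).resolve_left fun h'' =>
        hG.2 _ (((TransGen.single h'').tail ih1).tail h')
    · exact (hG.adj_iff.mp h2).resolve_left fun h'' =>
        hG.2 _ (((TransGen.single h'').tail ih2).tail h')

theorem Compelled.of_samePattern {G H : PDGraph V} (hGH : G.SamePattern H) {a b : V}
    (h : G.Compelled a b) : H.Compelled a b := by
  induction h with
  | vStructure h => exact .vStructure ((hGH.vStructure _ _ _).mp h)
  | flow _ h1 h2 h3 h4 ih =>
    rw [hGH.adj] at h1 h3
    rw [hGH.vStructure] at h4
    exact .flow ih h1 h2 h3 h4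
  | trans _ _ h ih1 ih2 => exact .trans ih1 ih2 ((hGH.adj _ _).mp h)
  | diamond h1 h2 h h3 h4 h5 _ _ ih1 ih2 =>
    rw [hGH.adj] at h1 h2 h h4
    rw [hGH.vStructure] at h5
    exact .diamond h1 h2 h h3 h4 h5 ih1 ih2

/-- The undirected graph of the edges of `G` that are not compelled. -/
def reversiblePart (G : PDGraph V) : SimpleGraph V where
  Adj a b := G.Adj a b ∧ ¬ G.Compelled a b ∧ ¬ G.Compelled b a
  symm := ⟨fun _ _ h => ⟨h.1.symm, h.2.2, h.2.1⟩⟩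
  loopless := ⟨fun a h => G.adj_irrefl a h.1⟩

theorem Compelled.reversiblePart_right {G : PDGraph V} {a b c : V}
    (h : G.Compelled a b) (hbc : G.reversiblePart.Adj b c) : G.Compelled a c := by
  -- This leaves only the possibility that `a - c` is itself reversible. For a v-structure the
  -- diamond rule would then compel `c → b`; for the flow rule, induction gives `d → c` and flow
  -- again compels `c → b`. The other two rules apply directly with `c` in place of `b`.
  have key : ∀ {a b c}, G.Compelled a b → G.reversiblePart.Adj b c →
      G.Adj a c ∧ ¬ G.Compelled c a := by
    intro a b c h ⟨hbc, h1, h2⟩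
    have hac : a ≠ c := by
      rintro rfl
      exact h2 h
    refine ⟨by_contra fun hn => h1 (.flow h hbc hac hn fun hv => h2 (.vStructure hv.symm)), ?_⟩
    exact fun hca => h2 (.trans hca h hbc.symm)
  induction h generalizing c with
  | @vStructure a b d h =>
    have hab := Compelled.vStructure h
    have hdb := Compelled.vStructure h.symm
    by_contra hn
    refine hbc.2.2 (.diamond (c := a) (d := d) (key hab hbc).1.symm (key hdb hbc).1.symm
      hbc.1.symm h.2.2.1 h.2.2.2 (fun hv => hn (.vStructure hv)) hab hdb)
  | @flow d a b hda hab hdb hn hv ih =>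
    by_contra hac
    have hk := key (.flow hda hab hdb hn hv) hbc
    have hdc := ih ⟨hk.1, hac, hk.2⟩
    exact hbc.2.2 (.flow hdc hbc.1.symm hdb hn fun h => hbc.2.1 (.vStructure h.symm))
  | @trans a d b had hdb hab _ ih =>
    exact .trans had (ih hbc) (key (.trans had hdb hab) hbc).1
  | @diamond a b x y h1 h2 h h3 h4 h5 hx hy ih1 ih2 =>
    exact .diamond h1 h2 (key (.diamond h1 h2 h h3 h4 h5 hx hy) hbc).1 h3 h4 h5 (ih1 hbc)
      (ih2 hbc)

/-! ### Perfect orderings and orientation of the reversible edges. -/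

/-- `l` is the reverse of a perfect ordering of vertices of `U`: the neighbours of a vertex that
come after it in `l` are pairwise adjacent. -/
def IsPerfect (U : SimpleGraph V) : List V → Prop
  | [] => True
  | s :: l => IsPerfect U l ∧ ∀ x ∈ l, ∀ y ∈ l, U.Adj s x → U.Adj s y → x ≠ y → U.Adj x y

theorem isPerfect_of_clique {U : SimpleGraph V} {l : List V}
    (h : ∀ x ∈ l, ∀ y ∈ l, x ≠ y → U.Adj x y) : IsPerfect U l := by
  induction l with
  | nil => trivial
  | cons s l ih =>
    refine ⟨ih fun x hx y hy => h x (by simp [hx]) y (by simp [hy]), fun x hx y hy _ _ => ?_⟩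
    exact h x (by simp [hx]) y (by simp [hy])

theorem IsPerfect.append_insert {U : SimpleGraph V} {m Q Q' : List V} {s : V}
    (h : IsPerfect U (m ++ Q)) (hQ' : IsPerfect U Q') (hs : ∀ x ∈ Q', x = s ∨ x ∈ Q)
    (hm : ∀ x ∈ m, ¬ U.Adj x s) : IsPerfect U (m ++ Q') := by
  induction m with
  | nil => exact hQ'
  | cons t m ih =>
    refine ⟨ih h.1 fun x hx => hm x (by simp [hx]), ?_⟩
    have ht : ∀ x ∈ m ++ Q', U.Adj t x → x ∈ m ++ Q := by
      intro x hx htx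
      rcases List.mem_append.mp hx with hx | hx
      · simp [hx]
      · rcases hs x hx with rfl | hx
        · exact absurd htx (hm t (by simp))
        · simp [hx]
    exact fun x hx y hy h1 h2 => h.2 x (ht x hx h1) y (ht y hy h2) h1 h2

/-- Every clique can be moved to the start of a perfect ordering. -/
theorem IsPerfect.exists_append_clique {U : SimpleGraph V} {l K : List V} (h : IsPerfect U l)
    (hl : l.Nodup) (hK : K.Nodup) (hKl : K ⊆ l) (hc : ∀ x ∈ K, ∀ y ∈ K, x ≠ y → U.Adj x y) :
    ∃ m, IsPerfect U (m ++ K) ∧ (m ++ K).Perm l := by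
  classical
  induction l generalizing K with
  | nil =>
    obtain rfl : K = [] := List.subset_nil.mp hKl
    exact ⟨[], trivial, .refl _⟩
  | cons s t ih =>
    obtain ⟨hst, ht⟩ := List.nodup_cons.mp hl
    by_cases hs : s ∈ K
    · set N := t.filter fun x => U.Adj s x ∧ x ∉ K with hN
      have hmN : ∀ x, x ∈ N ↔ x ∈ t ∧ U.Adj s x ∧ x ∉ K := by simp [hN]
      have hmK : ∀ x, x ∈ K.erase s ↔ x ≠ s ∧ x ∈ K := fun x => hK.mem_erase_iff
      have hadj : ∀ x ∈ N ++ K.erase s, x ∈ t ∧ U.Adj s x := by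
        intro x hx
        rcases List.mem_append.mp hx with hx | hx
        · exact ⟨((hmN x).mp hx).1, ((hmN x).mp hx).2.1⟩
        · obtain ⟨h1, h2⟩ := (hmK x).mp hx
          exact ⟨(List.mem_cons.mp (hKl h2)).resolve_left h1, hc s hs x h2 h1.symm⟩
      have hclique : ∀ x ∈ N ++ K.erase s, ∀ y ∈ N ++ K.erase s, x ≠ y → U.Adj x y :=
        fun x hx y hy => h.2 x (hadj x hx).1 y (hadj y hy).1 (hadj x hx).2 (hadj y hy).2
      obtain ⟨m, hm, hp⟩ := ih h.1 ht (K := N ++ K.erase s)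
        (List.nodup_append'.mpr ⟨ht.filter _, hK.erase s, fun x h1 h2 =>
          ((hmN x).mp h1).2.2 ((hmK x).mp h2).2⟩) (fun x hx => (hadj x hx).1) hclique
      refine ⟨m ++ N, ?_, ?_⟩
      · rw [List.append_assoc]
        refine hm.append_insert (s := s) (isPerfect_of_clique ?_) ?_ ?_
        · have hsx : ∀ x ∈ N ++ K, x = s ∨ x ∈ N ++ K.erase s := by
            intro x hx
            rw [List.mem_append, hmK]
            rcases List.mem_append.mp hx with hx | hx <;> tauto
          intro x hx y hy hxy
          rcases hsx x hx with rfl | hx <;> rcases hsx y hy with rfl | hy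
          · exact absurd rfl hxy
          · exact (hadj y hy).2
          · exact (hadj x hx).2.symm
          · exact hclique x hx y hy hxy
        · intro x hx
          rw [List.mem_append, hmK]
          rcases List.mem_append.mp hx with hx | hx <;> tauto
        · intro x hx hxs
          have hxt : x ∈ t := hp.subset (by simp [hx])
          have hdis := (List.nodup_append'.mp (hp.nodup_iff.mpr ht)).2.2
          refine hdis hx ?_
          rw [List.mem_append, hmN, hmK]
          have : x ≠ s := hxs.ne
          have := hxs.symm
          tauto
      · have h1 : (m ++ N ++ K).Perm (m ++ N ++ s :: K.erase s) :=
          (List.perm_cons_erase hs).append_left _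
        refine h1.trans (List.perm_middle.trans ?_)
        rw [List.append_assoc]
        exact hp.cons s
    · obtain ⟨m, hm, hp⟩ := ih h.1 ht hK
        (fun x hx => (List.mem_cons.mp (hKl hx)).resolve_left fun e => hs (e ▸ hx)) hc
      exact ⟨s :: m, ⟨hm, fun x hx y hy => h.2 x (hp.subset hx) y (hp.subset hy)⟩, hp.cons s⟩

theorem IsPerfect.adj_of_idxOf_lt [DecidableEq V] {U : SimpleGraph V} {l : List V}
    (h : IsPerfect U l) {x y z : V} (hx : x ∈ l) (hy : y ∈ l) (hzx : l.idxOf z < l.idxOf x)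
    (hzy : l.idxOf z < l.idxOf y) (h1 : U.Adj z x) (h2 : U.Adj z y) (hxy : x ≠ y) :
    U.Adj x y := by
  induction l with
  | nil => simp at hx
  | cons s t ih =>
    have hxs : x ≠ s := by
      rintro rfl
      simp at hzx
    have hys : y ≠ s := by
      rintro rfl
      simp at hzy
    replace hx := (List.mem_cons.mp hx).resolve_left hxs
    replace hy := (List.mem_cons.mp hy).resolve_left hys
    by_cases hzs : z = s
    · subst hzs
      exact h.2 x hx y hy h1 h2 hxy
    · rw [List.idxOf_cons_ne _ (Ne.symm hzs), List.idxOf_cons_ne _ (Ne.symm hxs)] at hzx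
      rw [List.idxOf_cons_ne _ (Ne.symm hzs), List.idxOf_cons_ne _ (Ne.symm hys)] at hzy
      exact ih h.1 hx hy (by omega) (by omega)

theorem exists_topological_list [Finite V] {r : V → V → Prop} (hr : ∀ v, ¬ TransGen r v v) :
    ∃ l : List V, l.Nodup ∧ (∀ x, x ∈ l) ∧ l.Pairwise fun x y => ¬ r x y := by
  classical
  have := Fintype.ofFinite V
  suffices H : ∀ s : Finset V, ∃ l : List V, l.Nodup ∧ (∀ x, x ∈ l ↔ x ∈ s) ∧
      l.Pairwise fun x y => ¬ r x y by
    obtain ⟨l, h1, h2, h3⟩ := H Finset.univ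
    exact ⟨l, h1, by simpa using h2, h3⟩
  intro s
  induction s using Finset.strongInduction with
  | _ s ih =>
    rcases s.eq_empty_or_nonempty with rfl | hs
    · exact ⟨[], by simp⟩
    · obtain ⟨v, hv, hmin⟩ := (wellFounded_of_acyclic (acyclic_swap hr)).has_min (s : Set V) hs
      obtain ⟨l, h1, h2, h3⟩ := ih (s.erase v) (Finset.erase_ssubset hv)
      refine ⟨v :: l, ?_, fun x => ?_, ?_⟩
      · simp [h1, h2]
      · rw [List.mem_cons, h2, Finset.mem_erase]
        by_cases hx : x = v
        · simpa [hx] using hv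
        · simp [hx]
      · refine List.pairwise_cons.mpr ⟨fun x hx => ?_, h3⟩
        exact hmin x (Finset.mem_of_mem_erase ((h2 x).mp hx))

/-- List sinks first, so that later neighbours are parents. Nonadjacent parents would form a
v-structure, and a compelled edge between two parents would compel an edge at their child. -/
theorem exists_isPerfect_reversiblePart [Finite V] {G : PDGraph V} (hG : G.IsDAG) :
    ∃ l : List V, l.Nodup ∧ (∀ x, x ∈ l) ∧ IsPerfect G.reversiblePart l := by
  obtain ⟨l, h1, h2, h3⟩ := exists_topological_list hG.2
  refine ⟨l, h1, h2, ?_⟩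
  clear h1 h2
  induction l with
  | nil => trivial
  | cons s l ih =>
    obtain ⟨h4, h5⟩ := List.pairwise_cons.mp h3
    refine ⟨ih h5, fun x hx y hy hsx hsy hxy => ?_⟩
    have hxs := (hG.adj_iff.mp hsx.1).resolve_left (h4 x hx)
    have hys := (hG.adj_iff.mp hsy.1).resolve_left (h4 y hy)
    refine ⟨by_contra fun hn => hsx.2.2 (.vStructure ⟨hxs, hys, hxy, hn⟩), fun h => ?_, fun h => ?_⟩
    · exact hsx.2.2 (h.reversiblePart_right hsy.symm)
    · exact hsy.2.2 (h.reversiblePart_right hsx.symm)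

theorem transGen_absorb {r e : V → V → Prop} (hre : ∀ a b c, r a b → e b c → r a c) {x y z : V}
    (h : TransGen r x y) (h' : ReflTransGen e y z) : TransGen r x z := by
  induction h' with
  | refl => exact h
  | tail _ hbc ih =>
    rcases TransGen.tail'_iff.mp ih with ⟨w, hxw, hwb⟩
    exact TransGen.tail' hxw (hre _ _ _ hwb hbc)

/-- An `e`-step after an `r`-step is absorbed. So a closed walk consists of `e`-steps only, or can
be rotated to start with `r` and reduced to `r`-steps only. -/
theorem acyclic_or {r e : V → V → Prop} (hre : ∀ a b c, r a b → e b c → r a c)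
    (hr : ∀ v, ¬ TransGen r v v) (he : ∀ v, ¬ TransGen e v v) :
    ∀ v, ¬ TransGen (fun x y => r x y ∨ e x y) v v := by
  have key : ∀ {x y}, TransGen (fun x y => r x y ∨ e x y) x y →
      TransGen e x y ∨ ∃ z, ReflTransGen e x z ∧ TransGen r z y := by
    intro x y h
    induction h with
    | single h =>
      rcases h with h | h
      · exact Or.inr ⟨x, .refl, .single h⟩
      · exact Or.inl (.single h)
    | tail _ h ih =>
      rcases h with h | h
      · rcases ih with ih | ⟨z, h1, h2⟩
        · exact Or.inr ⟨_, ih.to_reflTransGen, .single h⟩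
        · exact Or.inr ⟨z, h1, h2.tail h⟩
      · rcases ih with ih | ⟨z, h1, h2⟩
        · exact Or.inl (ih.tail h)
        · exact Or.inr ⟨z, h1, transGen_absorb hre h2 (.single h)⟩
  intro v h
  rcases key h with h | ⟨z, h1, h2⟩
  · exact he v h
  · exact hr z (transGen_absorb hre h2 h1)

/-- Both orientations of an edge that is not compelled occur among the DAGs with the same
pattern. -/
theorem exists_samePattern_dir [Finite V] {G : PDGraph V} (hG : G.IsDAG) {a b : V}
    (hab : G.reversiblePart.Adj a b) : ∃ H : PDGraph V, H.IsDAG ∧ G.SamePattern H ∧ H.dir b a := by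
  classical
  obtain ⟨l₀, hn₀, hall₀, hp₀⟩ := exists_isPerfect_reversiblePart hG
  obtain ⟨m, hperf, hperm⟩ := hp₀.exists_append_clique hn₀ (K := [a, b]) (by simpa using hab.ne)
    (fun x _ => hall₀ x) (by simp [hab, hab.symm])
  set l := m ++ [a, b] with hl
  have hn : l.Nodup := hperm.nodup_iff.mpr hn₀
  have hall : ∀ x, x ∈ l := fun x => hperm.mem_iff.mpr (hall₀ x)
  have hdis := (List.nodup_append'.mp hn).2.2
  have ham : a ∉ m := fun h => hdis h (by simp)
  have hbm : b ∉ m := fun h => hdis h (by simp)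
  have hba : l.idxOf a < l.idxOf b := by
    rw [hl, List.idxOf_append_of_notMem ham, List.idxOf_append_of_notMem hbm]
    simp [List.idxOf_cons_ne _ hab.ne]
  clear_value l
  -- Reversible edges point towards the front of `l`; since `b` is last, this gives `b → a`. A new
  -- v-structure with a compelled edge is excluded by absorption, one with two reversible edges by
  -- perfection of `l`.
  let E : V → V → Prop := fun x y => G.reversiblePart.Adj x y ∧ l.idxOf y < l.idxOf x
  have hME : ∀ x y z, G.Compelled x y → E y z → G.Compelled x z :=
    fun _ _ _ h1 h2 => h1.reversiblePart_right h2.1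
  have hE : ∀ v, ¬ TransGen E v v := by
    have : ∀ {x y}, TransGen E x y → l.idxOf y < l.idxOf x := by
      intro x y h
      induction h with
      | single h => exact h.2
      | tail _ h ih => exact h.2.trans ih
    exact fun v h => lt_irrefl _ (this h)
  have hM : ∀ v, ¬ TransGen G.Compelled v v := fun v h =>
    hG.2 v (TransGen.mono (fun _ _ h => h.dir hG) _ _ h)
  have hac := acyclic_or (r := G.Compelled) (e := E) hME hM hE
  let H : PDGraph V :=
    { dir := fun x y => G.Compelled x y ∨ E x y
      und := ⊥
      dir_asymm := fun x y h1 h2 => hac x (.tail (.single h1) h2)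
      dir_not_und := fun _ _ _ h => h }
  have hH : H.IsDAG := ⟨fun _ _ h => h, hac⟩
  have hadj : ∀ x y, G.Adj x y ↔ H.Adj x y := by
    intro x y
    rw [hH.adj_iff]
    constructor
    · intro h
      by_cases h1 : G.Compelled x y
      · exact Or.inl (Or.inl h1)
      · by_cases h2 : G.Compelled y x
        · exact Or.inr (Or.inl h2)
        · have h3 : G.reversiblePart.Adj x y := ⟨h, h1, h2⟩
          rcases lt_trichotomy (l.idxOf x) (l.idxOf y) with h4 | h4 | h4
          · exact Or.inr (Or.inr ⟨h3.symm, h4⟩)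
          · exact absurd ((List.idxOf_inj (hall x)).mp h4) h3.ne
          · exact Or.inl (Or.inr ⟨h3, h4⟩)
    · rintro ((h | h) | (h | h))
      exacts [Or.inl (h.dir hG), h.1.1, Or.inr (Or.inl (h.dir hG)), h.1.1.symm]
  refine ⟨H, hH, ⟨hadj, fun x y z => ⟨fun h => ?_, ?_⟩⟩, Or.inr ⟨hab.symm, hba⟩⟩
  · exact ⟨Or.inl (.vStructure h), Or.inl (.vStructure h.symm), h.2.2.1, by
      rw [← hadj]
      exact h.2.2.2⟩
  · rintro ⟨h1, h2, h3, h4⟩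
    rw [← hadj] at h4
    rcases h1 with h1 | h1 <;> rcases h2 with h2 | h2
    · exact ⟨h1.dir hG, h2.dir hG, h3, h4⟩
    · exact absurd (Or.inl ((h1.reversiblePart_right h2.1.symm).dir hG)) h4
    · exact absurd (Or.inr (Or.inl ((h2.reversiblePart_right h1.1.symm).dir hG))) h4
    · exact absurd (hperf.adj_of_idxOf_lt (hall x) (hall z) h1.2 h2.2 h1.1.symm h2.1.symm h3).1 h4

/-! ### Structure of CPDAGs. -/

/-- The directed edges of a CPDAG are the compelled edges. -/
theorem Represents.dir_iff [Finite V] {Gs G : PDGraph V} (hG : G.IsDAG) (h : Gs.Represents G)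
    {a b : V} : Gs.dir a b ↔ G.Compelled a b := by
  rw [h.2]
  constructor
  · intro hd
    have hab := hd G hG (.refl G)
    by_contra hn
    obtain ⟨H, hH, hGH, hba⟩ := exists_samePattern_dir hG (a := a) (b := b)
      ⟨Or.inl hab, hn, fun h' => G.dir_asymm _ _ hab (h'.dir hG)⟩
    exact H.dir_asymm _ _ hba (hd H hH (hGH.markovEquiv hG hH))
  · exact fun hc H hH hGH => (hc.of_samePattern (hGH.samePattern hG hH)).dir hH

theorem Represents.und_adj [Finite V] {Gs G : PDGraph V} (hG : G.IsDAG) (h : Gs.Represents G)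
    {a b : V} (hab : Gs.und.Adj a b) : G.reversiblePart.Adj a b := by
  refine ⟨(h.1 a b).mp (Or.inr (Or.inr hab)), ?_, ?_⟩
  · rw [← h.dir_iff hG]
    exact fun hd => Gs.dir_not_und _ _ hd hab
  · rw [← h.dir_iff hG]
    exact fun hd => Gs.dir_not_und _ _ hd hab.symm

theorem IsCPDAG.dir_of_dir_of_und [Finite V] {Gs : PDGraph V} (hGs : Gs.IsCPDAG) {a b c : V}
    (hab : Gs.dir a b) (hbc : Gs.und.Adj b c) : Gs.dir a c := by
  obtain ⟨G, hG, h⟩ := hGs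
  rw [h.dir_iff hG] at hab ⊢
  exact hab.reversiblePart_right (h.und_adj hG hbc)

theorem Represents.dir {Gs G : PDGraph V} (hG : G.IsDAG) (h : Gs.Represents G) {a b : V}
    (hab : Gs.dir a b) : G.dir a b :=
  (h.2 a b).mp hab G hG (.refl G)

theorem IsCPDAG.acyclic {Gs : PDGraph V} (hGs : Gs.IsCPDAG) : ∀ v, ¬ TransGen Gs.dir v v := by
  obtain ⟨G, hG, h⟩ := hGs
  exact fun v hv => hG.2 v (TransGen.mono (fun _ _ h' => h.dir hG h') _ _ hv)

theorem IsCPDAG.isExplicitCause {Gs : PDGraph V} (hGs : Gs.IsCPDAG) {x y : V}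
    (h : ReflTransGen Gs.dir x y) : Gs.IsExplicitCause x y := by
  obtain ⟨l, ⟨h1, _, h3, h4⟩, h5⟩ := exists_isDirectedPath hGs.acyclic h
  refine ⟨l, fun G hG => ?_⟩
  have : l.IsChain G.dir := h5.imp fun _ _ h' => hG.2.dir hG.1 h'
  exact ⟨⟨h1, this.imp fun _ _ h => Or.inl h, h3, h4⟩, this⟩

/-! ### Chordless partially directed paths. -/

theorem chordless_cons {G : PDGraph V} {a : V} {l : List V} :
    G.Chordless (a :: l) ↔ G.Chordless l ∧ ∀ x ∈ l.tail, ¬ G.Adj a x := by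
  constructor
  · intro h
    refine ⟨fun i j hij hj => ?_, fun x hx => ?_⟩
    · exact h (i + 1) (j + 1) (by omega) (by simpa using hj)
    · obtain ⟨k, hk, rfl⟩ := List.getElem_of_mem hx
      rw [List.length_tail] at hk
      rw [List.getElem_tail]
      exact h 0 (k + 2) (by omega) (by simp; omega)
  · rintro ⟨h1, h2⟩ i j hij hj
    obtain ⟨j, rfl⟩ : ∃ k, j = k + 1 := ⟨j - 1, by omega⟩
    cases i with
    | zero =>
      obtain ⟨j, rfl⟩ : ∃ k, j = k + 1 := ⟨j - 1, by omega⟩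
      have hj' : j < l.tail.length := by
        rw [List.length_tail]
        simp at hj
        omega
      simpa using h2 _ (List.getElem_mem hj')
    | succ i => simpa using h1 i j (by omega) (by simpa using hj)

theorem chordless_singleton (G : PDGraph V) (a : V) : G.Chordless [a] := by
  intro i j hij hj
  simp at hj
  omega

theorem Chordless.append_left {G : PDGraph V} {l l' : List V} (h : G.Chordless (l ++ l')) :
    G.Chordless l := by
  intro i j hij hj
  have := h i j hij (by simp; omega)
  rwa [List.getElem_append_left, List.getElem_append_left] at this

theorem Chordless.append_right {G : PDGraph V} {l l' : List V} (h : G.Chordless (l ++ l')) :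
    G.Chordless l' := by
  induction l with
  | nil => exact h
  | cons a l ih => exact ih (chordless_cons.mp h).1

/-- There is an edge `a → b` or `a - b`. -/
def PossiblyDir (G : PDGraph V) (a b : V) : Prop :=
  G.dir a b ∨ G.und.Adj a b

theorem PossiblyDir.adj {G : PDGraph V} {a b : V} (h : G.PossiblyDir a b) : G.Adj a b :=
  h.elim Or.inl fun h => Or.inr (Or.inr h)

theorem possiblyDir_iff {G : PDGraph V} {a b : V} :
    G.PossiblyDir a b ↔ G.Adj a b ∧ ¬ G.dir b a := by
  constructor
  · exact fun h => ⟨h.adj, fun h' => h.elim (G.dir_asymm _ _ h') fun h => G.dir_not_und _ _ h' h.symm⟩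
  · rintro ⟨h | h | h, h'⟩
    exacts [Or.inl h, absurd h h', Or.inr h]

theorem isPartiallyDirectedPath_iff {G : PDGraph V} {l : List V} {x y : V} :
    G.IsPartiallyDirectedPath l x y ↔
      l.Nodup ∧ l.IsChain G.PossiblyDir ∧ l.head? = some x ∧ l.getLast? = some y := by
  constructor
  · rintro ⟨⟨h1, h2, h3, h4⟩, h5⟩
    refine ⟨h1, ?_, h3, h4⟩
    clear h1 h3 h4
    induction l with
    | nil => simp
    | cons a l ih =>
      rw [List.isChain_cons] at h2 ⊢
      rw [List.isChain_cons] at h5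
      exact ⟨fun b hb => possiblyDir_iff.mpr ⟨h2.1 b hb, h5.1 b hb⟩, ih h5.2 h2.2⟩
  · rintro ⟨h1, h2, h3, h4⟩
    exact ⟨⟨h1, h2.imp fun _ _ h => h.adj, h3, h4⟩, h2.imp fun _ _ h => (possiblyDir_iff.mp h).2⟩

theorem reflTransGen_of_isChain_of_mem {r : V → V → Prop} {l : List V} {x w : V}
    (hl : (x :: l).IsChain r) (hw : w ∈ x :: l) : ReflTransGen r x w := by
  induction l generalizing x with
  | nil =>
    obtain rfl : w = x := by simpa using hw
    exact .refl
  | cons y l ih =>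
    rw [List.isChain_cons_cons] at hl
    rcases List.mem_cons.mp hw with rfl | hw
    · exact .refl
    · exact .head hl.1 (ih hl.2 hw)

theorem exists_last_of_exists_mem {P : V → Prop} {l : List V} (h : ∃ x ∈ l, P x) :
    ∃ s w t, l = s ++ w :: t ∧ P w ∧ ∀ x ∈ t, ¬ P x := by
  induction l with
  | nil => simp at h
  | cons a l ih =>
    by_cases h' : ∃ x ∈ l, P x
    · obtain ⟨s, w, t, rfl, h1, h2⟩ := ih h'
      exact ⟨a :: s, w, t, rfl, h1, h2⟩
    · push Not at h'
      obtain ⟨x, hx, hP⟩ := h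
      rcases List.mem_cons.mp hx with rfl | hx
      · exact ⟨[], x, l, rfl, hP, h'⟩
      · exact absurd hP (h' x hx)

theorem IsCPDAG.transGen_dir [Finite V] {Gs : PDGraph V} (hGs : Gs.IsCPDAG) {x y z : V} (h : TransGen Gs.dir x y)
    (h' : ReflTransGen Gs.PossiblyDir y z) : TransGen Gs.dir x z := by
  induction h' with
  | refl => exact h
  | tail _ hbc ih =>
    rcases hbc with hbc | hbc
    · exact ih.tail hbc
    · exact transGen_absorb (r := Gs.dir) (e := Gs.und.Adj) (fun _ _ _ => hGs.dir_of_dir_of_und) ih (.single hbc)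

/-- Build the path from its end: put `c` before its last neighbour `w` on the path found so far. The
edge cannot be `w → c`, as the way back from `c` to `w` would close a directed cycle. -/
theorem IsCPDAG.exists_chordless [Finite V] {Gs : PDGraph V} (hGs : Gs.IsCPDAG) {T : Set V} {c y : V}
    (h : ReflTransGen (fun u v => Gs.PossiblyDir u v ∧ v ∈ T) c y) :
    ∃ t : List V, (c :: t).Nodup ∧ (c :: t).IsChain Gs.PossiblyDir ∧ (c :: t).getLast? = some y ∧
      Gs.Chordless (c :: t) ∧ ∀ x ∈ t, x ∈ T := by
  induction h using ReflTransGen.head_induction_on with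
  | refl => exact ⟨[], by simp, by simp, by simp, chordless_singleton Gs y, by simp⟩
  | head hcd _ ih =>
    rename_i c d _
    obtain ⟨t, h1, h2, h3, h4, h5⟩ := ih
    have h5' : ∀ x ∈ d :: t, x ∈ T := by
      simpa [hcd.2] using h5
    by_cases hc : c ∈ d :: t
    · obtain ⟨s, t', hst⟩ := List.append_of_mem hc
      rw [hst] at h1 h2 h3 h4 h5'
      refine ⟨t', h1.of_append_right, h2.right_of_append, by simpa using h3, h4.append_right, ?_⟩
      exact fun x hx => h5' x (by simp [hx])
    · obtain ⟨s, w, t', hst, hw, ht'⟩ := exists_last_of_exists_mem (P := Gs.Adj c)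
        ⟨d, List.mem_cons_self, hcd.1.adj⟩
      have hdw : ReflTransGen Gs.PossiblyDir d w :=
        reflTransGen_of_isChain_of_mem h2 (by rw [hst]; simp)
      have hcw : Gs.PossiblyDir c w := possiblyDir_iff.mpr ⟨hw, fun hwc =>
        hGs.acyclic w (hGs.transGen_dir (.single hwc) (hdw.head hcd.1))⟩
      rw [hst] at h1 h2 h3 h4 h5' hc
      refine ⟨w :: t', List.nodup_cons.mpr ⟨fun h => hc (by simp [List.mem_cons.mp h]),
        h1.of_append_right⟩, List.isChain_cons_cons.mpr ⟨hcw, h2.right_of_append⟩,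
        by simpa using h3, chordless_cons.mpr ⟨h4.append_right, ht'⟩, ?_⟩
      exact fun x hx => h5' x (List.mem_append_right _ hx)

/-- A chordless partially directed path in a CPDAG consists of an undirected path followed by a
directed path. -/
theorem IsCPDAG.exists_split [Finite V] {Gs : PDGraph V} (hGs : Gs.IsCPDAG) {l : List V} (hne : l ≠ []) (hl : l.IsChain Gs.PossiblyDir)
    (hc : Gs.Chordless l) : ∃ p z q, l = p ++ z :: q ∧ (p ++ [z]).IsChain Gs.und.Adj ∧
      (z :: q).IsChain Gs.dir := by
  induction l with
  | nil => exact absurd rfl hne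
  | cons x l ih =>
    cases l with
    | nil => exact ⟨[], x, [], rfl, by simp, by simp⟩
    | cons y t =>
      rw [List.isChain_cons_cons] at hl
      rw [chordless_cons] at hc
      obtain ⟨p, z, q, h1, h2, h3⟩ := ih (by simp) hl.2 hc.1
      cases p with
      | nil =>
        obtain ⟨rfl, rfl⟩ : y = z ∧ t = q := by simpa using h1
        rcases hl.1 with hxy | hxy
        · exact ⟨[], x, y :: t, rfl, by simp, List.isChain_cons_cons.mpr ⟨hxy, h3⟩⟩
        · exact ⟨[x], y, t, rfl, by simpa using hxy, h3⟩
      | cons y' p =>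
        obtain ⟨rfl, rfl⟩ : y = y' ∧ t = p ++ z :: q := by simpa using h1
        rcases hl.1 with hxy | hxy
        -- Here `x → y - w`, so `x → w` is a chord.
        · exfalso
          have : ∃ w r, p ++ [z] = w :: r := by
            cases p with
            | nil => exact ⟨z, [], rfl⟩
            | cons w r => exact ⟨w, r ++ [z], rfl⟩
          obtain ⟨w, r, hwr⟩ := this
          rw [List.cons_append, hwr, List.isChain_cons_cons] at h2
          refine hc.2 w ?_ (Or.inl (hGs.dir_of_dir_of_und hxy h2.1))
          have : w ∈ p ++ [z] := by simp [hwr]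
          simp only [List.tail_cons]
          grind
        · exact ⟨x :: y :: p, z, q, rfl, List.isChain_cons_cons.mpr ⟨hxy, h2⟩, h3⟩

/-! ### The two inclusions. -/

theorem IsCPDAG.criticalSet_subset [Finite V] {Gs : PDGraph V} (hGs : Gs.IsCPDAG) {X Y : V}
    (hX : ¬ Gs.IsExplicitCause X Y) :
    Gs.criticalSet X Y ⊆ ⋃ Z ∈ Gs.ancestors Y ∩ Gs.chainComponent X, Gs.criticalSet X Z := by
  rintro c ⟨hXc, l, hl, hch, hcl⟩
  rw [isPartiallyDirectedPath_iff] at hl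
  obtain ⟨h1, h2, h3, h4⟩ := hl
  obtain ⟨p, z, q, rfl, hp, hq⟩ := hGs.exists_split (by rintro rfl; simp at hcl) h2 hch
  have hzY : ReflTransGen Gs.dir z Y := reflTransGen_of_isChain hq rfl (by simpa using h4)
  cases p with
  | nil =>
    obtain rfl : z = X := by simpa using h3
    exact absurd (hGs.isExplicitCause hzY) hX
  | cons x p =>
    obtain rfl : x = X := by simpa using h3
    have hcX : c ≠ x := by
      rintro rfl
      exact Gs.adj_irrefl _ hXc
    -- On a chordless path only the second vertex is adjacent to the first, and it comes no later
    -- than `z` since `z` is not the first vertex.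
    have hcp : c ∈ x :: p ++ [z] := by
      have hc1 : c ∈ p ++ z :: q := (List.mem_cons.mp hcl).resolve_left hcX
      have hc2 : c ∉ (p ++ z :: q).tail := fun h => (chordless_cons.mp hch).2 c h hXc
      cases p with
      | nil =>
        have : c = z := by simpa [show c ∉ q from hc2] using hc1
        simp [this]
      | cons y p =>
        have : c = y := (List.mem_cons.mp hc1).resolve_right hc2
        simp [this]
    have hsplit : x :: p ++ z :: q = (x :: p ++ [z]) ++ q := by simp
    rw [hsplit] at h1 h2 hch
    have hxz : ReflTransGen Gs.und.Adj x z := reflTransGen_of_isChain_of_mem hp (by simp)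
    refine Set.mem_iUnion₂.mpr ⟨z, ⟨(mem_ancestors_iff hGs.acyclic).mpr hzY,
      (SimpleGraph.reachable_iff_reflTransGen _ _).mpr hxz⟩, hXc, x :: p ++ [z], ?_,
      hch.append_left, hcp⟩
    rw [isPartiallyDirectedPath_iff]
    exact ⟨h1.of_append_left, h2.left_of_append, rfl, List.getLast?_concat⟩

theorem IsCPDAG.criticalSet_subset_of_mem [Finite V] {Gs : PDGraph V} (hGs : Gs.IsCPDAG)
    {X Y Z : V} (hX : ¬ Gs.IsExplicitCause X Y) (hZY : Z ∈ Gs.ancestors Y)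
    (hZX : Z ∈ Gs.chainComponent X) : Gs.criticalSet X Z ⊆ Gs.criticalSet X Y := by
  rintro c ⟨hXc, l, hl, hch, hcl⟩
  rw [isPartiallyDirectedPath_iff] at hl
  obtain ⟨h1, h2, h3, h4⟩ := hl
  rw [mem_ancestors_iff hGs.acyclic] at hZY
  have hXZ : ReflTransGen Gs.und.Adj X Z := (SimpleGraph.reachable_iff_reflTransGen _ _).mp hZX
  have hnZX : ¬ TransGen Gs.dir Z X := fun h =>
    hGs.acyclic Z (transGen_absorb (r := Gs.dir) (fun _ _ _ => hGs.dir_of_dir_of_und) h hXZ)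
  cases l with
  | nil => simp at hcl
  | cons x m =>
    obtain rfl : x = X := by simpa using h3
    have hcX : c ≠ x := by
      rintro rfl
      exact Gs.adj_irrefl _ hXc
    have hcm := (List.mem_cons.mp hcl).resolve_left hcX
    obtain ⟨hxm, -⟩ := List.nodup_cons.mp h1
    have hnadj := (chordless_cons.mp hch).2
    cases m with
    | nil => simp at hcm
    | cons c' m =>
      obtain rfl : c = c' := (List.mem_cons.mp hcm).resolve_right fun h => hnadj c h hXc
      rw [List.isChain_cons_cons] at h2
      -- Keeping every vertex after `c` in `T` ensures that `x` can be prepended without a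
      -- repetition or a chord once the walk is shortened.
      let T : Set V := {v | v ≠ x ∧ ¬ Gs.Adj x v}
      have hmT : ∀ v ∈ m, v ∈ T := fun v hv =>
        ⟨fun h => hxm (by simp [← h, hv]), hnadj v hv⟩
      have hcZ : ReflTransGen (fun u v => Gs.PossiblyDir u v ∧ v ∈ T) c Z := by
        refine reflTransGen_of_isChain (l := c :: m) ?_ rfl (by simpa using h4)
        have h2' := h2.2
        clear * - h2' hmT
        induction m generalizing c with
        | nil => simp
        | cons d m ih =>
          rw [List.isChain_cons_cons] at h2' ⊢
          exact ⟨⟨h2'.1, hmT d (by simp)⟩, ih (fun v hv => hmT v (by simp [hv])) h2'.2⟩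
      have hT : ∀ {v}, TransGen Gs.dir Z v → ReflTransGen Gs.dir v Y → v ∈ T := by
        intro v hZv hvY
        refine ⟨?_, ?_⟩
        · rintro rfl
          exact hnZX hZv
        · rintro (h | h | h)
          · exact hX (hGs.isExplicitCause (hvY.head h))
          · exact hnZX (hZv.tail h)
          · exact hnZX (hGs.transGen_dir hZv (.single (Or.inr h.symm)))
      have hZY' : ReflTransGen (fun u v => Gs.PossiblyDir u v ∧ v ∈ T) Z Y := by
        suffices H : ∀ {u}, ReflTransGen Gs.dir u Y → ReflTransGen Gs.dir Z u →
            ReflTransGen (fun u v => Gs.PossiblyDir u v ∧ v ∈ T) u Y from H hZY .refl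
        intro u hu
        induction hu using ReflTransGen.head_induction_on with
        | refl => exact fun _ => .refl
        | head hab hbY ih =>
          exact fun hZa => .head ⟨Or.inl hab, hT (TransGen.tail' hZa hab) hbY⟩ (ih (hZa.tail hab))
      obtain ⟨t, t1, t2, t3, t4, t5⟩ := hGs.exists_chordless (hcZ.trans hZY')
      refine ⟨hXc, x :: c :: t, ?_, chordless_cons.mpr ⟨t4, fun v hv => (t5 v hv).2⟩, by simp⟩
      rw [isPartiallyDirectedPath_iff]
      refine ⟨List.nodup_cons.mpr ⟨fun h => ?_, t1⟩, List.isChain_cons_cons.mpr ⟨h2.1, t2⟩, rfl,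
        by simpa using t3⟩
      rcases List.mem_cons.mp h with h | h
      · exact hcX h.symm
      · exact (t5 x h).1 rfl

end PDGraph

theorem proposition4 {V : Type*} [Finite V] (Gs : PDGraph V) (hGs : Gs.IsCPDAG)
    (X Y : V) (hXY : X ≠ Y) (hX : ¬ Gs.IsExplicitCause X Y) :
    Gs.criticalSet X Y =
      ⋃ Z ∈ Gs.ancestors Y ∩ Gs.chainComponent X, Gs.criticalSet X Z :=
  (hGs.criticalSet_subset hX).antisymm
    (Set.iUnion₂_subset fun _ hZ => hGs.criticalSet_subset_of_mem hX hZ.1 hZ.2)
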